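/- **Setting.** Let $X$ be a closed subset of a separable Banach space, with the induced metric $d_X$; let $Y$ be a complete separable metric space and $\mathcal H$ a separable real Hilbert space. Let $F\colon X\rightsquigarrow Y$ be a set-valued function with non-empty images $Z_x:=F(x)$ and closed graph $Z:=\{(x,y)\in X\times Y: y\in Z_x\}$, and let $g\colon Z\to\mathcal H$ and $f\colon\mathcal H\to\mathbb R$. For a Borel probability measure $m$ on $X$ let $\mathcal P_m(Z)$ be the set of Borel probability measures on $Z$ whose marginal on $X$ is $m$, and consider $$(\mathrm P_m)\qquad \mathrm{val}(\mathrm P_m)=\inf_{\mu\in\mathcal P_m(Z)} f\Big(\int_Z g\,d\mu\Big).$$ For $\epsilon\ge 0$, an $\epsilon$-minimizer of $(\mathrm P_m)$ is a $\mu\in\mathcal P_m(Z)$ with $f(\int_Z g\,d\mu)\le \mathrm{val}(\mathrm P_m)+\epsilon$. **Assumptions.** (A1) $g$ is bounded; $f$ is convex and differentiable, and $\nabla f$ is Lipschitz continuous with modulus $L$. (A2) For every $\lambda\in\nabla f(\mathcal H)$: the function $g_\lambda:=\langle\lambda,g\rangle$ is lower semi-continuous on $Z$; the set-valued function $x\mapsto\{g_\lambda(x,y):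 y\in Z_x\}$ is lower semi-continuous; and $y\mapsto g_\lambda(x,y)$ attains its minimum on $Z_x$ for every $x\in X$. (B) $g$ is continuous; every $Z_x$ is compact and $F$ is upper semi-continuous; and $L_g\ge 0$ is such that the set-valued function $\mathcal Z(x):=\{g(x,y): y\in Z_x\}$ is $L_g$-Lipschitz, i.e. $\mathcal Z(x_1)\subseteq \mathcal Z(x_2)+\bar B(0,L_g d_X(x_1,x_2))$ for all $x_1,x_2\in X$. Set $$M:=\sup_{z\in Z}\|g(z)\|,\qquad C:=\sup_{\mu\in\mathcal P(Z)}\Big\|\nabla f\Big(\int_Z g\,d\mu\Big)\Big\|,\qquad d_1(m_0,m_1):=\sup_{\varphi\ 1\text{-Lipschitz}}\int_X\varphi\,d(m_0-m_1),$$ where $\mathcal P(Z)$ is the set of Borel probability measures on $Z$ and $\varphi$ ranges over the $1$-Lipschitz functions $X\to\mathbb R$. **Bridging method.** Given $m_0,m_1$ and $\bar\mu_0\in\mathcal P_{m_0}(Z)$: choose a coupling $\rho$ of $m_0$ and $m_1$ that minimizes $\int d_X(x,x')\,d\rho(x,x')$ among all couplings; choose a probability measure $\nu$ on $Z\times X$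 whose image under $(x,y,x')\mapsto(x,y)$ is $\bar\mu_0$ and whose image under $(x,y,x')\mapsto(x,x')$ is $\rho$; choose a Borel map $s\colon Z\times X\to Z$ with $s(x,y,x')\in S(x,y,x')$ everywhere, where $$S(x,y,x'):=\{(x',y')\in Z:\ \|g(x',y')-g(x,y)\|\le L_g\,d_X(x,x')\}.$$ The output is the push-forward $\mu_1:=s\#\nu$. **Theorem.** Under (A1), (A2) and (B), let $m_0,m_1$ be Borel probability measures on $X$ with finite first moment. Then: 1. $\mathrm{val}(\mathrm P_{m_0})$ and $\mathrm{val}(\mathrm P_{m_1})$ are finite (the feasible sets are non-empty and the costs bounded below), and $$|\mathrm{val}(\mathrm P_{m_0})-\mathrm{val}(\mathrm P_{m_1})|\le L_g\,(C+LM)\,d_1(m_0,m_1).$$ 2. Let $\epsilon_0\ge 0$ and let $\bar\mu_0$ be an $\epsilon_0$-minimizer of $(\mathrm P_{m_0})$. Then the bridging method with input $m_0,m_1,\bar\mu_0$ can be carried out, and every output $\mu_1$ of it belongs to $\mathcal P_{m_1}(Z)$ and is an $\eta$-minimizer of $(\mathrm P_{m_1})$ with $$\eta=\epsilon_0+2L_g\,(C+LM)\,d_1(m_0,m_1).$$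 -/

import Mathlib

open MeasureTheory Set
open scoped NNReal ENNReal Pointwise

noncomputable section

namespace MFO

/-- The Borel probability measure `m` has a finite first moment. -/
def FiniteFirstMoment {X : Type*} [MetricSpace X] [MeasurableSpace X] (m : Measure X) : Prop :=
  IsProbabilityMeasure m ∧ ∃ x₀ : X, Integrable (fun x => dist x x₀) m

/-- The Kantorovich–Rubinstein distance: the supremum of `∫ φ d(m₀ - m₁)` over all `1`-Lipschitz
functions `φ`. -/
def krDist {X : Type*} [MetricSpace X] [MeasurableSpace X] (m₀ m₁ : Measure X) : ℝ :=
  ⨆ φ : {φ : X → ℝ // LipschitzWith 1 φ}, ((∫ x, φ.1 x ∂m₀) - ∫ x, φ.1 x ∂m₁)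

/-- The set `Π(m₀, m₁)` of couplings. -/
def couplings {X X' : Type*} [MeasurableSpace X] [MeasurableSpace X']
    (m₀ : Measure X) (m₁ : Measure X') : Set (Measure (X × X')) :=
  {ρ | IsProbabilityMeasure ρ ∧ ρ.map Prod.fst = m₀ ∧ ρ.map Prod.snd = m₁}

/-- `ρ` solves the optimal transport problem between `m₀` and `m₁` with cost the distance. -/
def IsOptimalCoupling {X : Type*} [MetricSpace X] [MeasurableSpace X]
    (m₀ m₁ : Measure X) (ρ : Measure (X × X)) : Prop :=
  ρ ∈ couplings m₀ m₁ ∧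
    ∀ ρ' ∈ couplings m₀ m₁, ∫⁻ p, edist p.1 p.2 ∂ρ ≤ ∫⁻ p, edist p.1 p.2 ∂ρ'

/-- The graph of a set-valued function. -/
def graph {X Y : Type*} (F : X → Set Y) : Set (X × Y) := {p | p.2 ∈ F p.1}

/-- The set-valued function `F` is `K`-Lipschitz: `F x₁ ⊆ F x₂ + B(0, K d(x₁, x₂))`, with closed
balls. -/
def SetValuedLipschitz {X H : Type*} [MetricSpace X] [NormedAddCommGroup H]
    (K : ℝ) (F : X → Set H) : Prop :=
  ∀ x₁ x₂ : X, F x₁ ⊆ F x₂ + Metric.closedBall (0 : H) (K * dist x₁ x₂)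

section Problem

variable {X Y H : Type*} [MetricSpace X] [MeasurableSpace X] [MetricSpace Y] [MeasurableSpace Y]
  [NormedAddCommGroup H] [InnerProductSpace ℝ H] [CompleteSpace H]

/-- The set of probability measures on `Z = graph F` whose first marginal is `m`. -/
def admissible (F : X → Set Y) (m : Measure X) : Set (Measure (graph F)) :=
  {μ | IsProbabilityMeasure μ ∧ μ.map (fun z => z.1.1) = m}

/-- The cost `f (∫_Z g dμ)`. -/
def cost {F : X → Set Y} (g : graph F → H) (f : H → ℝ) (μ : Measure (graph F)) : ℝ :=
  f (∫ z, g z ∂μ)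

/-- The value of the problem with marginal `m`. -/
def val {F : X → Set Y} (g : graph F → H) (f : H → ℝ) (m : Measure X) : ℝ :=
  sInf (cost g f '' admissible F m)

/-- `μ` is an `ε`-minimizer of the problem with marginal `m`. -/
def IsApproxMinimizer {F : X → Set Y} (g : graph F → H) (f : H → ℝ) (m : Measure X)
    (ε : ℝ) (μ : Measure (graph F)) : Prop :=
  μ ∈ admissible F m ∧ ∀ μ' ∈ admissible F m, cost g f μ ≤ cost g f μ' + ε

/-- The set-valued function `x ↦ {⟪l, g (x, y)⟫ | y ∈ F x}`. -/
def scalarImage {F : X → Set Y} (g : graph F → H) (l : H) (x : X) : Set ℝ :=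
  {r | ∃ (y : Y) (hy : y ∈ F x), r = inner ℝ l (g ⟨(x, y), hy⟩)}

/-- The best responses, i.e. the minimizers of `y ↦ ⟪l, g (x, y)⟫` over `F x`. -/
def bestResponse {F : X → Set Y} (g : graph F → H) (l : H) (x : X) : Set Y :=
  {y | ∃ hy : y ∈ F x, ∀ (y' : Y) (hy' : y' ∈ F x),
    inner ℝ l (g ⟨(x, y), hy⟩) ≤ inner ℝ l (g ⟨(x, y'), hy'⟩)}

/-- The set-valued function `x ↦ {g (x, y) | y ∈ F x}`. -/
def contributions {F : X → Set Y} (g : graph F → H) (x : X) : Set H :=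
  {h | ∃ (y : Y) (hy : y ∈ F x), h = g ⟨(x, y), hy⟩}

/-- The regularity assumptions on the cost; `L` is a Lipschitz modulus of `∇ f`. -/
structure CostAssumption {F : X → Set Y} (g : graph F → H) (f : H → ℝ) (L : ℝ≥0) : Prop where
  bounded : ∃ B : ℝ, ∀ z, ‖g z‖ ≤ B
  convex : ConvexOn ℝ univ f
  differentiable : Differentiable ℝ f
  lipschitz_gradient : LipschitzWith L (gradient f)
  lsc : ∀ l ∈ range (gradient f), LowerSemicontinuous fun z => inner ℝ l (g z)
  lsc_image : ∀ l ∈ range (gradient f), LowerHemicontinuous (scalarImage g l)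
  bestResponse_nonempty : ∀ l ∈ range (gradient f), ∀ x, (bestResponse g l x).Nonempty

/-- The assumptions of the stability analysis, apart from the one on the space `X`; `Lg` is a
Lipschitz modulus of `contributions g`. -/
structure StabilityAssumption {F : X → Set Y} (g : graph F → H) (Lg : ℝ) : Prop where
  continuous : Continuous g
  compact : ∀ x, IsCompact (F x)
  usc : UpperHemicontinuous F
  modulus_nonneg : 0 ≤ Lg
  lipschitz : SetValuedLipschitz Lg (contributions g)

/-- `M = sup_Z ‖g‖`. -/
def constM {F : X → Set Y} (g : graph F → H) : ℝ := ⨆ z, ‖g z‖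

/-- `C = sup ‖∇ f (∫_Z g dμ)‖` over all probability measures `μ` on `Z`. -/
def constC {F : X → Set Y} (g : graph F → H) (f : H → ℝ) : ℝ :=
  ⨆ μ : ProbabilityMeasure (graph F), ‖gradient f (∫ z, g z ∂(μ : Measure (graph F)))‖

/-- The transfer map
`S (x, y, x') = {(x', y') ∈ Z | ‖g (x', y') - g (x, y)‖ ≤ Lg * d(x, x')}`. -/
def transfer {F : X → Set Y} (g : graph F → H) (Lg : ℝ) (p : graph F × X) : Set (graph F) :=
  {z | z.1.1 = p.2 ∧ ‖g z - g p.1‖ ≤ Lg * dist p.1.1.1 p.2}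

/-- `μ₁` is an output of the bridging method with input `m₀, m₁, μ₀`: take an optimal coupling `ρ`
of `m₀, m₁`, a probability measure `ν` on `Z × X` that glues `μ₀` and `ρ`, a Borel selection `s`
of the transfer map, and push `ν` forward by `s`. -/
def IsBridgingOutput {F : X → Set Y} (g : graph F → H) (Lg : ℝ) (m₀ m₁ : Measure X)
    (μ₀ μ₁ : Measure (graph F)) : Prop :=
  ∃ (ρ : Measure (X × X)) (ν : Measure (graph F × X)) (s : graph F × X → graph F),
    IsOptimalCoupling m₀ m₁ ρ ∧
    IsProbabilityMeasure ν ∧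
    ν.map Prod.fst = μ₀ ∧
    ν.map (fun p => (p.1.1.1, p.2)) = ρ ∧
    Measurable s ∧
    (∀ p, s p ∈ transfer g Lg p) ∧
    μ₁ = ν.map s

end Problem

end MFO

end

/-!
The bridging step moves `∫ g` by at most `Lg` times the optimal transport cost of `m₀, m₁`, which
equals `d₁(m₀, m₁)` by Kantorovich–Rubinstein duality. For finitely many points the duality is
linear programming duality, obtained here from Hahn–Banach separation; the general case follows by
discretising the marginals with nearest-point simple functions and lifting the discrete couplings
back to `m₀, m₁` by gluing. The gradient inequality for the convex `f` turns the displacement of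
`∫ g` into a cost increase of at most `C * Lg * d₁(m₀, m₁)`, where `C` bounds `‖∇ f‖` at the
integrals `∫ g`. Bridging from `m₀` to `m₁` and back compares the two values, and hence bounds the
suboptimality of the output. Borel selections of compact-valued maps come from minimising
lexicographically the distances to a dense sequence.
-/

namespace MFO

section MeasurableSelection

variable {P Z : Type*} [MetricSpace Z] {Φ : P → Set Z} {z : ℕ → Z}

/-- Iterated minimisation: `lexMin Φ z n p` consists of the points of `Φ p` that minimise the
distances to `z 0, …, z (n - 1)` lexicographically. For a dense sequence `z` these sets shrink to a
single point, which serves as a canonical selection of `Φ`. -/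
def lexMin (Φ : P → Set Z) (z : ℕ → Z) : ℕ → P → Set Z
  | 0, p => Φ p
  | n + 1, p => {y ∈ lexMin Φ z n p | ∀ y' ∈ lexMin Φ z n p, dist y (z n) ≤ dist y' (z n)}

lemma lexMin_succ_subset (Φ : P → Set Z) (z : ℕ → Z) (n : ℕ) (p : P) :
    lexMin Φ z (n + 1) p ⊆ lexMin Φ z n p := fun _ hy => hy.1

lemma isCompact_lexMin (hc : ∀ p, IsCompact (Φ p)) (z : ℕ → Z) (n : ℕ) (p : P) :
    IsCompact (lexMin Φ z n p) := by
  induction n with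
  | zero => exact hc p
  | succ n ih =>
    have heq : lexMin Φ z (n + 1) p =
        lexMin Φ z n p ∩ ⋂ y' ∈ lexMin Φ z n p, {y | dist y (z n) ≤ dist y' (z n)} := by
      ext y; simp [lexMin]
    rw [heq]
    exact ih.inter_right <| isClosed_biInter fun y' _ => isClosed_le (by fun_prop) (by fun_prop)

lemma lexMin_nonempty (hc : ∀ p, IsCompact (Φ p)) (hn : ∀ p, (Φ p).Nonempty) (z : ℕ → Z) (n : ℕ)
    (p : P) : (lexMin Φ z n p).Nonempty := by
  induction n with
  | zero => exact hn p
  | succ n ih =>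
    obtain ⟨y, hy, hmin⟩ := (isCompact_lexMin hc z n p).exists_isMinOn ih
      (f := fun y => dist y (z n)) (by fun_prop)
    exact ⟨y, hy, fun y' hy' => hmin hy'⟩

lemma lexMin_succ_inter_nonempty_iff (hc : ∀ p, IsCompact (Φ p)) (n : ℕ) (p : P) {A : Set Z}
    (hA : IsClosed A) : (lexMin Φ z (n + 1) p ∩ A).Nonempty ↔ (lexMin Φ z n p ∩ A).Nonempty ∧
      ∀ q : ℚ, (lexMin Φ z n p ∩ Metric.closedBall (z n) q).Nonempty →
        (lexMin Φ z n p ∩ (A ∩ Metric.closedBall (z n) q)).Nonempty := by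
  constructor
  · rintro ⟨y, hy, hyA⟩
    exact ⟨⟨y, hy.1, hyA⟩, fun q ⟨y', hy', hq⟩ => ⟨y, hy.1, hyA, (hy.2 y' hy').trans hq⟩⟩
  · rintro ⟨hne, hq⟩
    obtain ⟨y, hy, hmin⟩ := ((isCompact_lexMin hc z n p).inter_right hA).exists_isMinOn hne
      (f := fun y => dist y (z n)) (by fun_prop)
    refine ⟨y, ⟨hy.1, fun y' hy' => ?_⟩, hy.2⟩
    by_contra! hlt
    obtain ⟨q, hy'q, hqy⟩ := exists_rat_btwn hlt
    obtain ⟨w, hw, hwA, hwq⟩ := hq q ⟨y', hy', hy'q.le⟩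
    have hyw : dist y (z n) ≤ dist w (z n) := hmin ⟨hw, hwA⟩
    exact (hqy.trans_le (hyw.trans hwq)).false

lemma measurableSet_lexMin_inter_nonempty [MeasurableSpace P] (hc : ∀ p, IsCompact (Φ p))
    (hm : ∀ A : Set Z, IsClosed A → MeasurableSet {p | (Φ p ∩ A).Nonempty}) (z : ℕ → Z) (n : ℕ)
    {A : Set Z} (hA : IsClosed A) : MeasurableSet {p | (lexMin Φ z n p ∩ A).Nonempty} := by
  induction n generalizing A with
  | zero => exact hm A hA
  | succ n ih =>
    simp only [lexMin_succ_inter_nonempty_iff hc n _ hA, ofPred_and, ofPred_forall]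
    exact (ih hA).inter <| .iInter fun q =>
      (ih Metric.isClosed_closedBall).imp (ih (hA.inter Metric.isClosed_closedBall))

lemma iInter_lexMin_inter_nonempty (hc : ∀ p, IsCompact (Φ p)) {p : P} {A : Set Z}
    (hA : IsClosed A) (h : ∀ n, (lexMin Φ z n p ∩ A).Nonempty) :
    ((⋂ n, lexMin Φ z n p) ∩ A).Nonempty := by
  rw [iInter_inter]
  exact IsCompact.nonempty_iInter_of_sequence_nonempty_isCompact_isClosed _
    (fun n => inter_subset_inter_left _ (lexMin_succ_subset Φ z n p)) h
    ((isCompact_lexMin hc z 0 p).inter_right hA)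
    (fun n => (isCompact_lexMin hc z n p).isClosed.inter hA)

lemma subsingleton_iInter_lexMin (Φ : P → Set Z) (hz : DenseRange z) (p : P) :
    (⋂ n, lexMin Φ z n p).Subsingleton := by
  intro y hy y' hy'
  rw [mem_iInter] at hy hy'
  have hdist (n : ℕ) : dist y (z n) = dist y' (z n) :=
    le_antisymm ((hy (n + 1)).2 _ (hy' n)) ((hy' (n + 1)).2 _ (hy n))
  have heq : dist y = dist y' :=
    hz.equalizer (by fun_prop) (by fun_prop) (funext hdist)
  simpa using congrFun heq y'

theorem exists_measurable_selection [MeasurableSpace P] [SecondCountableTopology Z]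
    [MeasurableSpace Z] [BorelSpace Z] (hc : ∀ p, IsCompact (Φ p)) (hn : ∀ p, (Φ p).Nonempty)
    (hm : ∀ A : Set Z, IsClosed A → MeasurableSet {p | (Φ p ∩ A).Nonempty}) :
    ∃ s : P → Z, Measurable s ∧ ∀ p, s p ∈ Φ p := by
  rcases isEmpty_or_nonempty P with hP | ⟨⟨p₀⟩⟩
  · exact ⟨fun p => isEmptyElim p, measurable_of_empty _, fun p => isEmptyElim p⟩
  have : Nonempty Z := (hn p₀).to_type
  let z := TopologicalSpace.denseSeq Z
  have hne (p : P) : (⋂ n, lexMin Φ z n p).Nonempty := by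
    simpa using iInter_lexMin_inter_nonempty hc isClosed_univ
      fun n => by simpa using lexMin_nonempty hc hn z n p
  choose s hs using hne
  refine ⟨s, measurable_of_isClosed fun A hA => ?_, fun p => mem_iInter.1 (hs p) 0⟩
  have hpre : s ⁻¹' A = ⋂ n, {p | (lexMin Φ z n p ∩ A).Nonempty} := by
    ext p
    simp only [mem_preimage, mem_iInter]
    refine ⟨fun h n => ⟨s p, mem_iInter.1 (hs p) n, h⟩, fun h => ?_⟩
    obtain ⟨y, hy, hyA⟩ := iInter_lexMin_inter_nonempty hc hA h
    rwa [subsingleton_iInter_lexMin Φ (TopologicalSpace.denseRange_denseSeq Z) p (hs p) hy]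
  rw [hpre]
  exact .iInter fun n => measurableSet_lexMin_inter_nonempty hc hm z n hA

lemma exists_measurable_section_of_isProperMap [TopologicalSpace P] [T1Space P]
    [MeasurableSpace P] [BorelSpace P] [SecondCountableTopology Z] [MeasurableSpace Z]
    [BorelSpace Z] {π : Z → P} (hπ : IsProperMap π) (hs : Function.Surjective π) :
    ∃ s : P → Z, Measurable s ∧ Function.RightInverse s π := by
  refine exists_measurable_selection (Φ := fun p => π ⁻¹' {p})
    (fun p => hπ.isCompact_preimage isCompact_singleton)
    (fun p => singleton_nonempty p |>.preimage hs) fun A hA => ?_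
  have himage : {p | (π ⁻¹' {p} ∩ A).Nonempty} = π '' A := by
    ext p
    exact ⟨fun ⟨z, hz, hzA⟩ => ⟨z, hzA, hz⟩, fun ⟨z, hzA, hz⟩ => ⟨z, hz, hzA⟩⟩
  rw [himage]
  exact (hπ.isClosedMap A hA).measurableSet

end MeasurableSelection

section GraphProjection

variable {X Y H : Type*} [MetricSpace X] [NormedAddCommGroup H] {F : X → Set Y}
  {g : graph F → H} {Lg : ℝ}

lemma transfer_nonempty (hlip : SetValuedLipschitz Lg (contributions g)) (p : graph F × X) :
    (transfer g Lg p).Nonempty := by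
  obtain ⟨⟨⟨x, y⟩, hy⟩, x'⟩ := p
  obtain ⟨_, ⟨y', hy', rfl⟩, b, hb, hab⟩ := hlip x x' ⟨y, hy, rfl⟩
  have hab' : g ⟨(x', y'), hy'⟩ + b = g ⟨(x, y), hy⟩ := hab
  refine ⟨⟨(x', y'), hy'⟩, rfl, ?_⟩
  rw [← hab', sub_add_cancel_left, norm_neg]
  simpa using hb

variable [MetricSpace Y]

lemma isCompact_preimage_graph_fst {x : X} (hc : IsCompact (F x)) :
    IsCompact ((fun z : graph F => z.1.1) ⁻¹' {x}) := by
  rw [Topology.IsEmbedding.subtypeVal.isCompact_iff]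
  have himage : Subtype.val '' ((fun z : graph F => z.1.1) ⁻¹' {x}) = {x} ×ˢ F x := by
    ext ⟨x', y⟩
    simp only [graph, mem_image, mem_preimage, mem_singleton_iff, Subtype.exists, mem_prod,
      mem_ofPred_eq, exists_and_left, exists_prop, exists_eq_right_right]
    exact and_congr_right fun h => by rw [h]
  rw [himage]
  exact isCompact_singleton.prod hc

lemma isClosedMap_graph_fst (hc : ∀ x, IsCompact (F x)) (hu : UpperHemicontinuous F) :
    IsClosedMap fun z : graph F => z.1.1 := by
  intro A hA
  obtain ⟨B, hB, rfl⟩ := isClosed_induced_iff.1 hA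
  rw [← isOpen_compl_iff, isOpen_iff_mem_nhds]
  intro x hx
  have hdisj : {x} ×ˢ F x ⊆ Bᶜ := by
    rintro ⟨x', y⟩ ⟨rfl, hy⟩ hB'
    exact hx ⟨⟨(x', y), hy⟩, hB', rfl⟩
  obtain ⟨u, v, hu', hv, hxu, hFv, huv⟩ := generalized_tube_lemma isCompact_singleton (hc x)
    hB.isOpen_compl hdisj
  filter_upwards [hu'.mem_nhds (hxu rfl), hu.forall_isOpen x v hv hFv] with x' hx'u hx'v
  rintro ⟨z, hz, rfl⟩
  exact huv ⟨hx'u, hx'v z.2⟩ hz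

lemma isProperMap_graph_fst (hc : ∀ x, IsCompact (F x)) (hu : UpperHemicontinuous F) :
    IsProperMap fun z : graph F => z.1.1 :=
  isProperMap_iff_isClosedMap_and_compact_fibers.2
    ⟨by fun_prop, isClosedMap_graph_fst hc hu, fun x => isCompact_preimage_graph_fst (hc x)⟩

variable [MeasurableSpace X] [BorelSpace X] [SecondCountableTopology X]
  [MeasurableSpace Y] [BorelSpace Y] [SecondCountableTopology Y]

lemma exists_measurable_section_graph_fst (hn : ∀ x, (F x).Nonempty) (hc : ∀ x, IsCompact (F x))
    (hu : UpperHemicontinuous F) : ∃ s : X → graph F, Measurable s ∧ ∀ x, (s x).1.1 = x :=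
  exists_measurable_section_of_isProperMap (isProperMap_graph_fst hc hu)
    fun x => ⟨⟨(x, (hn x).some), (hn x).some_mem⟩, rfl⟩

lemma exists_measurable_transfer (hstab : StabilityAssumption g Lg) :
    ∃ s : graph F × X → graph F, Measurable s ∧ ∀ p, s p ∈ transfer g Lg p := by
  have hg := hstab.continuous
  let R : Set (graph F × graph F) := {q | ‖g q.2 - g q.1‖ ≤ Lg * dist q.1.1.1 q.2.1.1}
  have hR : IsClosed R := isClosed_le (by fun_prop) (by fun_prop)
  let π : R → graph F × X := Prod.map id (fun z => z.1.1) ∘ Subtype.val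
  have hπ : IsProperMap π :=
    (isProperMap_id.prodMap (isProperMap_graph_fst hstab.compact hstab.usc)).comp
      hR.isProperMap_subtypeVal
  obtain ⟨s, hs, hsπ⟩ := exists_measurable_section_of_isProperMap hπ fun p => by
    obtain ⟨z, hzx, hz⟩ := transfer_nonempty hstab.lipschitz p
    exact ⟨⟨(p.1, z), by simpa [R, hzx] using hz⟩, Prod.ext rfl hzx⟩
  refine ⟨fun p => (s p).1.2, by fun_prop, fun p => ?_⟩
  have hfst : (s p).1.1 = p.1 := congrArg Prod.fst (hsπ p)
  have hsnd : (s p).1.2.1.1 = p.2 := congrArg Prod.snd (hsπ p)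
  have hle : ‖g (s p).1.2 - g (s p).1.1‖ ≤ Lg * dist (s p).1.1.1.1 (s p).1.2.1.1 := (s p).2
  rw [hfst, hsnd] at hle
  exact ⟨hsnd, hle⟩

end GraphProjection

section Gluing

open ProbabilityTheory

variable {α β γ δ : Type*} [MeasurableSpace α] [MeasurableSpace β] [MeasurableSpace γ]
  [MeasurableSpace δ]

lemma map_swap_mem_couplings {μ : Measure α} {ν : Measure β} {ρ : Measure (α × β)}
    (hρ : ρ ∈ couplings μ ν) : ρ.map Prod.swap ∈ couplings ν μ := by
  have := hρ.1
  refine ⟨Measure.isProbabilityMeasure_map (by fun_prop), ?_, ?_⟩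
  · rw [Measure.map_map (by fun_prop) (by fun_prop)]
    exact hρ.2.2
  · rw [Measure.map_map (by fun_prop) (by fun_prop)]
    exact hρ.2.1

theorem exists_gluing [StandardBorelSpace γ] {μ : Measure α} [IsProbabilityMeasure μ]
    {ν : Measure γ} {h : α → β} (hh : Measurable h) {ρ : Measure (β × γ)}
    (hρ : ρ ∈ couplings (μ.map h) ν) :
    ∃ κ ∈ couplings μ ν, κ.map (Prod.map h id) = ρ := by
  obtain ⟨hprob, hfst, hsnd⟩ := hρ
  have : Nonempty γ := (nonempty_of_isProbabilityMeasure ρ).map Prod.snd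
  let κ := μ ⊗ₘ (ρ.condKernel.comap h hh)
  have hmeas : Measurable (Prod.map h (id : γ → γ)) := by fun_prop
  have hκρ : κ.map (Prod.map h id) = ρ := by
    conv_rhs => rw [← ρ.disintegrate ρ.condKernel]
    ext A hA
    rw [Measure.map_apply hmeas hA, Measure.compProd_apply (hmeas hA), Measure.compProd_apply hA,
      Measure.fst, hfst, lintegral_map (Kernel.measurable_kernel_prodMk_left hA) hh]
    rfl
  refine ⟨κ, ⟨inferInstance, Measure.fst_compProd _ _, ?_⟩, hκρ⟩
  rw [← hsnd, ← hκρ, Measure.map_map measurable_snd hmeas]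
  rfl

lemma exists_coupling_map_eq [StandardBorelSpace α] [StandardBorelSpace δ] {μ : Measure α}
    [IsProbabilityMeasure μ] {ν : Measure γ} [IsProbabilityMeasure ν] {h : α → β} {k : γ → δ}
    (hh : Measurable h) (hk : Measurable k) {σ : Measure (β × δ)}
    (hσ : σ ∈ couplings (μ.map h) (ν.map k)) :
    ∃ ρ ∈ couplings μ ν, ρ.map (Prod.map h k) = σ := by
  obtain ⟨τ, hτ, rfl⟩ := exists_gluing hh hσ
  obtain ⟨κ, hκ, hκτ⟩ := exists_gluing hk (map_swap_mem_couplings hτ)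
  refine ⟨κ.map Prod.swap, map_swap_mem_couplings hκ, ?_⟩
  have hτκ : τ = (κ.map (Prod.map k id)).map Prod.swap := by
    rw [hκτ, Measure.map_map measurable_swap measurable_swap, Prod.swap_swap_eq, Measure.map_id]
  rw [hτκ, Measure.map_map (by fun_prop) (by fun_prop), Measure.map_map (by fun_prop) (by fun_prop),
    Measure.map_map (by fun_prop) (by fun_prop)]
  rfl

end Gluing

section OptimalCoupling

lemma continuous_lintegral_min {Ω : Type*} [TopologicalSpace Ω] [MeasurableSpace Ω]
    [OpensMeasurableSpace Ω] {c : Ω → ℝ≥0} (hc : Continuous c) (n : ℝ≥0) :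
    Continuous fun μ : ProbabilityMeasure Ω => ∫⁻ x, (min (c x) n : ℝ≥0) ∂(μ : Measure Ω) := by
  let φ : BoundedContinuousFunction Ω ℝ≥0 :=
    BoundedContinuousFunction.mkOfBound ⟨fun x => min (c x) n, by fun_prop⟩ n fun x y => by
      have hmem (z : Ω) : ((min (c z) n : ℝ≥0) : ℝ) ∈ Icc (0 : ℝ) n :=
        ⟨NNReal.coe_nonneg _, NNReal.coe_le_coe.2 (min_le_right _ _)⟩
      exact (Real.dist_le_of_mem_Icc (hmem x) (hmem y)).trans_eq (sub_zero _)
  exact ProbabilityMeasure.continuous_lintegral_boundedContinuousFunction φ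

lemma lintegral_eq_iSup_lintegral_min {Ω : Type*} [MeasurableSpace Ω] {c : Ω → ℝ≥0}
    (hc : Measurable c) (μ : Measure Ω) :
    ∫⁻ x, c x ∂μ = ⨆ n : ℕ, ∫⁻ x, (min (c x) n : ℝ≥0) ∂μ := by
  rw [← lintegral_iSup (f := fun (n : ℕ) x => ((min (c x) n : ℝ≥0) : ℝ≥0∞)) (fun n => by fun_prop)
    fun m n hmn x => ENNReal.coe_le_coe.2 (min_le_min le_rfl (Nat.cast_le.2 hmn))]
  refine lintegral_congr fun x => le_antisymm ?_ (iSup_le fun n => by simp)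
  obtain ⟨n, hn⟩ := exists_nat_ge (c x)
  exact le_iSup_of_le n (by rw [min_eq_left hn])

lemma lowerSemicontinuous_lintegral {Ω : Type*} [TopologicalSpace Ω] [MeasurableSpace Ω]
    [OpensMeasurableSpace Ω] {c : Ω → ℝ≥0} (hc : Continuous c) :
    LowerSemicontinuous fun μ : ProbabilityMeasure Ω => ∫⁻ x, c x ∂(μ : Measure Ω) := by
  simp only [lintegral_eq_iSup_lintegral_min hc.measurable]
  exact lowerSemicontinuous_iSup fun n => (continuous_lintegral_min hc n).lowerSemicontinuous

section Compactness

variable {X X' : Type*} [MetricSpace X] [MeasurableSpace X] [BorelSpace X]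
  [MetricSpace X'] [MeasurableSpace X'] [BorelSpace X'] [SecondCountableTopology X']
  (m₀ : Measure X) (m₁ : Measure X')

lemma isClosed_couplings [IsProbabilityMeasure m₀] [IsProbabilityMeasure m₁] :
    IsClosed {ρ : ProbabilityMeasure (X × X') | (ρ : Measure (X × X')) ∈ couplings m₀ m₁} := by
  have heq : {ρ : ProbabilityMeasure (X × X') | (ρ : Measure (X × X')) ∈ couplings m₀ m₁} =
      {ρ | ρ.map (f := Prod.fst) (by fun_prop) = ⟨m₀, inferInstance⟩} ∩
        {ρ | ρ.map (f := Prod.snd) (by fun_prop) = ⟨m₁, inferInstance⟩} := by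
    ext ρ
    exact ⟨fun h => ⟨Subtype.ext h.2.1, Subtype.ext h.2.2⟩,
      fun h => ⟨inferInstance, congrArg Subtype.val h.1, congrArg Subtype.val h.2⟩⟩
  rw [heq]
  exact (isClosed_eq (ProbabilityMeasure.continuous_map continuous_fst) continuous_const).inter
    (isClosed_eq (ProbabilityMeasure.continuous_map continuous_snd) continuous_const)

lemma isTightMeasureSet_couplings [CompleteSpace X] [SecondCountableTopology X] [CompleteSpace X']
    [IsProbabilityMeasure m₀] [IsProbabilityMeasure m₁] : IsTightMeasureSet (couplings m₀ m₁) := by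
  refine IsTightMeasureSet.prodMk ((isTightMeasureSet_singleton (μ := m₀)).subset ?_)
    ((isTightMeasureSet_singleton (μ := m₁)).subset ?_)
  · rintro _ ⟨ρ, hρ, rfl⟩
    exact hρ.2.1
  · rintro _ ⟨ρ, hρ, rfl⟩
    exact hρ.2.2

lemma isCompact_couplings [CompleteSpace X] [SecondCountableTopology X] [CompleteSpace X']
    [IsProbabilityMeasure m₀] [IsProbabilityMeasure m₁] :
    IsCompact {ρ : ProbabilityMeasure (X × X') | (ρ : Measure (X × X')) ∈ couplings m₀ m₁} := by
  rw [← (isClosed_couplings m₀ m₁).closure_eq]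
  refine isCompact_closure_of_isTightMeasureSet
    ((isTightMeasureSet_couplings m₀ m₁).subset ?_)
  rintro _ ⟨ρ, hρ, rfl⟩
  exact hρ

end Compactness

theorem exists_isOptimalCoupling {X : Type*} [MetricSpace X] [MeasurableSpace X] [BorelSpace X]
    [SecondCountableTopology X] [CompleteSpace X] (m₀ m₁ : Measure X) [IsProbabilityMeasure m₀]
    [IsProbabilityMeasure m₁] : ∃ ρ, IsOptimalCoupling m₀ m₁ ρ := by
  have hprod : m₀.prod m₁ ∈ couplings m₀ m₁ := ⟨inferInstance, Measure.fst_prod, Measure.snd_prod⟩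
  obtain ⟨ρ, hρ, hmin⟩ := LowerSemicontinuousOn.exists_isMinOn
    ⟨⟨m₀.prod m₁, inferInstance⟩, hprod⟩ (isCompact_couplings m₀ m₁)
    ((lowerSemicontinuous_lintegral continuous_nndist).lowerSemicontinuousOn _)
  simp only [← edist_nndist] at hmin
  exact ⟨ρ, hρ, fun ρ' hρ' => hmin (a := ⟨ρ', hρ'.1⟩) hρ'⟩

end OptimalCoupling

section FiniteDuality

theorem exists_mem_apply_eq_and_le {E G : Type*} [AddCommGroup E] [Module ℝ E]
    [TopologicalSpace E] [AddCommGroup G] [Module ℝ G] [TopologicalSpace G]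
    [IsTopologicalAddGroup G] [ContinuousSMul ℝ G] [LocallyConvexSpace ℝ G] [T1Space G]
    {K : Set E} (hK : IsCompact K) (hKc : Convex ℝ K) (A : E →L[ℝ] G) (ℓ : E →L[ℝ] ℝ) {b : G}
    (hb : b ∈ A '' K) {r : ℝ} (h : ∀ f : G →L[ℝ] ℝ, ∃ w ∈ K, ℓ w + f (A w - b) ≤ r) :
    ∃ w ∈ K, A w = b ∧ ℓ w ≤ r := by
  by_contra! hcon
  have hdisj : Disjoint (A.prod ℓ '' K) ({b} ×ˢ Iic r) := by
    rw [disjoint_left]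
    rintro _ ⟨w, hw, rfl⟩ ⟨hwb, hwr⟩
    exact (hcon w hw hwb).not_ge hwr
  obtain ⟨F, u, v, hu, huv, hv⟩ := geometric_hahn_banach_compact_closed
    (hKc.linear_image (A.prod ℓ).toLinearMap) (hK.image (A.prod ℓ).continuous)
    ((convex_singleton b).prod (convex_Iic r)) (isClosed_singleton.prod isClosed_Iic) hdisj
  let f : G →L[ℝ] ℝ := F.comp (.inl ℝ G ℝ)
  let k : ℝ := F (0, 1)
  have hF (y : G) (t : ℝ) : F (y, t) = f y + k * t := by
    have hsplit : (y, t) = (y, (0 : ℝ)) + t • ((0 : G), (1 : ℝ)) := by simp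
    rw [hsplit, map_add, map_smul, smul_eq_mul, mul_comm]
    rfl
  have hK_lt (w : E) (hw : w ∈ K) : f (A w) + k * ℓ w < u := by
    rw [← hF]
    exact hu _ (mem_image_of_mem _ hw)
  have hlt_b (t : ℝ) (ht : t ≤ r) : v < f b + k * t := by
    rw [← hF]
    exact hv _ ⟨rfl, ht⟩
  -- As `b` is feasible, the separating hyperplane is not vertical; its slope is the multiplier.
  have hk : k < 0 := by
    obtain ⟨w, hw, rfl⟩ := hb
    by_contra! hk
    have hmono := mul_le_mul_of_nonneg_left (min_le_right r (ℓ w)) hk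
    linarith [hK_lt w hw, hlt_b _ (min_le_left r (ℓ w))]
  obtain ⟨w, hw, hwr⟩ := h (k⁻¹ • f)
  have hmul := mul_le_mul_of_nonpos_left hwr hk.le
  have hcancel : k * (ℓ w + (k⁻¹ • f) (A w - b)) = k * ℓ w + (f (A w) - f b) := by
    rw [smul_apply, map_sub, smul_eq_mul, mul_add, mul_inv_cancel_left₀ hk.ne]
  linarith [hK_lt w hw, hlt_b r le_rfl]

section Weights

variable {ι κ : Type*} [Fintype ι] [Fintype κ]

/-- The pair of marginals of a family of weights on the finite product `ι × κ`. -/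
def marginals (ι κ : Type*) [Fintype ι] [Fintype κ] : (ι × κ → ℝ) →L[ℝ] (ι → ℝ) × (κ → ℝ) :=
  .prod (.pi fun i => ∑ j, .proj (i, j)) (.pi fun j => ∑ i, .proj (i, j))

lemma marginals_apply (w : ι × κ → ℝ) :
    marginals ι κ w = (fun i => ∑ j, w (i, j), fun j => ∑ i, w (i, j)) := by
  ext <;> simp [marginals]

lemma marginals_single [DecidableEq ι] [DecidableEq κ] (i : ι) (j : κ) :
    marginals ι κ (Pi.single (i, j) 1) = (Pi.single i 1, Pi.single j 1) := by
  rw [marginals_apply]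
  ext x
  · by_cases hx : x = i <;> simp [Pi.single_apply, hx, -Finset.sum_boole]
  · by_cases hx : x = j <;> simp [Pi.single_apply, hx, -Finset.sum_boole]

lemma mem_marginals_image_stdSimplex {p : ι → ℝ} {q : κ → ℝ} (hp : p ∈ stdSimplex ℝ ι)
    (hq : q ∈ stdSimplex ℝ κ) : (p, q) ∈ marginals ι κ '' stdSimplex ℝ (ι × κ) := by
  refine ⟨fun x => p x.1 * q x.2, ⟨fun x => mul_nonneg (hp.1 _) (hq.1 _), ?_⟩, ?_⟩
  · simp [Fintype.sum_prod_type, ← Finset.mul_sum, hp.2, hq.2]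
  · simp [marginals_apply, ← Finset.mul_sum, ← Finset.sum_mul, hp.2, hq.2]

lemma apply_prod_eq_sum_single [DecidableEq ι] [DecidableEq κ]
    (f : (ι → ℝ) × (κ → ℝ) →L[ℝ] ℝ) (x : ι → ℝ) (y : κ → ℝ) :
    f (x, y) = ∑ i, f (Pi.single i 1, 0) * x i + ∑ j, f (0, Pi.single j 1) * y j := by
  have hx : (x, (0 : κ → ℝ)) = ∑ i, x i • (Pi.single i 1, 0) := by
    ext k <;> simp [Prod.fst_sum, Prod.snd_sum, Finset.sum_apply, Pi.single_apply]
  have hy : ((0 : ι → ℝ), y) = ∑ j, y j • (0, Pi.single j 1) := by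
    ext k <;> simp [Prod.fst_sum, Prod.snd_sum, Finset.sum_apply, Pi.single_apply]
  have hxy : (x, y) = (x, 0) + (0, y) := by simp
  rw [hxy, map_add, hx, hy]
  simp only [map_sum, map_smul, smul_eq_mul, mul_comm]

theorem exists_mem_stdSimplex_marginals_eq {p : ι → ℝ} {q : κ → ℝ} (hp : p ∈ stdSimplex ℝ ι)
    (hq : q ∈ stdSimplex ℝ κ) (c : ι → κ → ℝ) {r : ℝ}
    (h : ∀ (φ : ι → ℝ) (ψ : κ → ℝ), (∀ i j, φ i + ψ j ≤ c i j) →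
      ∑ i, φ i * p i + ∑ j, ψ j * q j ≤ r) :
    ∃ w ∈ stdSimplex ℝ (ι × κ), marginals ι κ w = (p, q) ∧ ∑ x, c x.1 x.2 * w x ≤ r := by
  classical
  have hpq := mem_marginals_image_stdSimplex hp hq
  let ℓ : (ι × κ → ℝ) →L[ℝ] ℝ := ∑ x, c x.1 x.2 • .proj x
  have hℓ (w : ι × κ → ℝ) : ℓ w = ∑ x, c x.1 x.2 * w x := by simp [ℓ]
  simp only [← hℓ]
  refine exists_mem_apply_eq_and_le (isCompact_stdSimplex ℝ _) (convex_stdSimplex ℝ _)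
    (marginals ι κ) ℓ hpq fun f => ?_
  let a : ι → ℝ := fun i => f (Pi.single i 1, 0)
  let b : κ → ℝ := fun j => f (0, Pi.single j 1)
  have hne : Nonempty (ι × κ) := by
    by_contra hempty
    rw [not_nonempty_iff] at hempty
    obtain ⟨w, hw, -⟩ := hpq
    simpa using hw.2
  obtain ⟨⟨i, j⟩, hmin⟩ := Finite.exists_min fun x : ι × κ => c x.1 x.2 + a x.1 + b x.2
  refine ⟨Pi.single (i, j) 1, single_mem_stdSimplex ℝ _, ?_⟩
  have hdual := h (fun i' => c i j + a i + b j - a i') (fun j' => -b j') fun i' j' => by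
    linarith [hmin (i', j')]
  have hfpq : f (p, q) = ∑ i, a i * p i + ∑ j, b j * q j := apply_prod_eq_sum_single f p q
  have hfij : f (Pi.single i 1, Pi.single j 1) = a i + b j := by
    rw [← map_add]
    simp
  have hℓij : ℓ (Pi.single (i, j) 1) = c i j := by simp [hℓ, Pi.single_apply]
  simp only [sub_mul, neg_mul, Finset.sum_sub_distrib, Finset.sum_neg_distrib, ← Finset.mul_sum,
    hp.2, mul_one] at hdual
  rw [hℓij, marginals_single, map_sub, hfij, hfpq]
  linarith

end Weights

section Measures

variable {X X' : Type*} [MeasurableSpace X] [MeasurableSingletonClass X]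
  [MeasurableSpace X'] [MeasurableSingletonClass X']

lemma measureReal_singleton_mem_stdSimplex [Fintype X] (m : Measure X) [IsProbabilityMeasure m] :
    (fun x => m.real {x}) ∈ stdSimplex ℝ X := by
  refine ⟨fun x => measureReal_nonneg, ?_⟩
  simp

lemma exists_measureReal_singleton_eq [Fintype X] {w : X → ℝ} (hw : w ∈ stdSimplex ℝ X) :
    ∃ ρ : Measure X, IsProbabilityMeasure ρ ∧ ∀ x, ρ.real {x} = w x := by
  have hsum : ∑ x, ENNReal.ofReal (w x) = 1 := by
    rw [← ENNReal.ofReal_sum_of_nonneg fun x _ => hw.1 x, hw.2, ENNReal.ofReal_one]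
  refine ⟨(PMF.ofFintype _ hsum).toMeasure, inferInstance, fun x => ?_⟩
  rw [measureReal_def, PMF.toMeasure_apply_singleton _ _ (measurableSet_singleton x),
    PMF.ofFintype_apply, ENNReal.toReal_ofReal (hw.1 x)]

theorem exists_coupling_integral_le_of_finite [Finite X] [Finite X'] (m₀ : Measure X)
    (m₁ : Measure X') [IsProbabilityMeasure m₀] [IsProbabilityMeasure m₁] (c : X → X' → ℝ) {r : ℝ}
    (h : ∀ (φ : X → ℝ) (ψ : X' → ℝ), (∀ x x', φ x + ψ x' ≤ c x x') →
      ∫ x, φ x ∂m₀ + ∫ x, ψ x ∂m₁ ≤ r) :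
    ∃ ρ ∈ couplings m₀ m₁, ∫ p, c p.1 p.2 ∂ρ ≤ r := by
  have := Fintype.ofFinite X
  have := Fintype.ofFinite X'
  simp only [integral_fintype .of_finite, smul_eq_mul, mul_comm (Measure.real _ _)] at h
  obtain ⟨w, hw, hmarg, hwr⟩ := exists_mem_stdSimplex_marginals_eq
    (measureReal_singleton_mem_stdSimplex m₀) (measureReal_singleton_mem_stdSimplex m₁) c h
  obtain ⟨ρ, hρ, hρw⟩ := exists_measureReal_singleton_eq hw
  rw [marginals_apply] at hmarg
  refine ⟨ρ, ⟨hρ, ?_, ?_⟩, ?_⟩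
  · have := Measure.isProbabilityMeasure_map (μ := ρ) measurable_fst.aemeasurable
    refine Measure.ext_of_measureReal_singleton fun x => ?_
    rw [map_measureReal_apply measurable_fst (measurableSet_singleton x), measureReal_def,
      measure_preimage_fst_singleton_eq_sum, ENNReal.toReal_sum fun _ _ => measure_ne_top _ _]
    simpa only [← measureReal_def, hρw] using congrFun (congrArg Prod.fst hmarg) x
  · have := Measure.isProbabilityMeasure_map (μ := ρ) measurable_snd.aemeasurable
    refine Measure.ext_of_measureReal_singleton fun x => ?_
    rw [map_measureReal_apply measurable_snd (measurableSet_singleton x), measureReal_def,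
      measure_preimage_snd_singleton_eq_sum, ENNReal.toReal_sum fun _ _ => measure_ne_top _ _]
    simpa only [← measureReal_def, hρw] using congrFun (congrArg Prod.snd hmarg) x
  · rw [integral_fintype .of_finite]
    simpa only [hρw, smul_eq_mul, mul_comm (w _)] using hwr

end Measures

end FiniteDuality

section KantorovichRubinstein

open Filter Topology

lemma exists_lipschitzWith_between {X : Type*} [PseudoMetricSpace X] {φ ψ : X → ℝ}
    (h : ∀ x y, φ x + ψ y ≤ dist x y) : ∃ Φ, LipschitzWith 1 Φ ∧ φ ≤ Φ ∧ Φ ≤ -ψ := by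
  let Φ : X → ℝ := fun x => ⨅ y, (dist x y - ψ y)
  have hbdd (x : X) : BddBelow (range fun y => dist x y - ψ y) :=
    ⟨φ x, forall_mem_range.2 fun y => le_sub_iff_add_le.2 (h x y)⟩
  refine ⟨Φ, .of_le_add fun x x' => ?_, fun x => ?_, fun x => ?_⟩
  · have := Nonempty.intro x
    rw [← sub_le_iff_le_add]
    refine le_ciInf fun y => ?_
    have hle : Φ x ≤ dist x y - ψ y := ciInf_le (hbdd x) y
    linarith [dist_triangle x x' y]
  · have := Nonempty.intro x
    exact le_ciInf fun y => le_sub_iff_add_le.2 (h x y)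
  · exact (ciInf_le (hbdd x) x).trans_eq (by rw [dist_self, zero_sub, Pi.neg_apply])

lemma exists_lipschitzWith_comp_val_eq {X : Type*} [PseudoMetricSpace X] {s : Set X} {K : ℝ≥0}
    {φ : s → ℝ} (hφ : LipschitzWith K φ) : ∃ Φ : X → ℝ, LipschitzWith K Φ ∧ ∀ x : s, Φ x = φ x := by
  have hval (x : s) : Function.extend Subtype.val φ 0 x = φ x :=
    Subtype.val_injective.extend_apply φ 0 x
  have hon : LipschitzOnWith K (Function.extend Subtype.val φ 0) s := fun x hx y hy => by
    simpa only [← hval, Subtype.edist_eq] using hφ ⟨x, hx⟩ ⟨y, hy⟩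
  obtain ⟨Φ, hΦ, heq⟩ := hon.extend_real
  exact ⟨Φ, hΦ, fun x => (heq x.2).symm.trans (hval x)⟩

variable {X : Type*} [MetricSpace X] [MeasurableSpace X]

lemma krDist_comm (m₀ m₁ : Measure X) : krDist m₀ m₁ = krDist m₁ m₀ := by
  let e : {φ : X → ℝ // LipschitzWith 1 φ} ≃ {φ : X → ℝ // LipschitzWith 1 φ} :=
    (Equiv.neg (X → ℝ)).subtypeEquiv fun φ => lipschitzWith_neg_iff.symm
  refine e.iSup_congr fun φ => ?_
  have he : ((e φ).1 : X → ℝ) = fun x => -φ.1 x := rfl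
  rw [he, integral_neg, integral_neg, neg_sub_neg]

variable [BorelSpace X] {m₀ m₁ : Measure X}

lemma FiniteFirstMoment.integrable_of_lipschitzWith {m : Measure X} (hm : FiniteFirstMoment m)
    {φ : X → ℝ} (hφ : LipschitzWith 1 φ) : Integrable φ m := by
  obtain ⟨_, x₀, hx₀⟩ := hm
  refine (hx₀.add (integrable_const |φ x₀|)).mono' hφ.continuous.measurable.aestronglyMeasurable
    (.of_forall fun x => ?_)
  have hdist := hφ.dist_le_mul x x₀
  rw [Real.dist_eq, NNReal.coe_one, one_mul] at hdist
  exact sub_le_iff_le_add.1 ((abs_sub_abs_le_abs_sub (φ x) (φ x₀)).trans hdist)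

lemma FiniteFirstMoment.lintegral_edist_ne_top {m : Measure X} (hm : FiniteFirstMoment m) (y : X) :
    ∫⁻ x, edist x y ∂m ≠ ∞ := by
  simpa only [edist_dist] using
    (hm.integrable_of_lipschitzWith (LipschitzWith.dist_left y)).lintegral_lt_top.ne

lemma bddAbove_krDist (hm₀ : FiniteFirstMoment m₀) (hm₁ : FiniteFirstMoment m₁) :
    BddAbove (range fun φ : {φ : X → ℝ // LipschitzWith 1 φ} =>
      (∫ x, φ.1 x ∂m₀) - ∫ x, φ.1 x ∂m₁) := by
  obtain ⟨hp₀, x₀, hx₀⟩ := id hm₀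
  have hp₁ := hm₁.1
  have hx₁ := hm₁.integrable_of_lipschitzWith (LipschitzWith.dist_left x₀)
  refine ⟨∫ x, dist x x₀ ∂m₀ + ∫ x, dist x x₀ ∂m₁, forall_mem_range.2 fun ⟨φ, hφ⟩ => ?_⟩
  have hle (x : X) : |φ x - φ x₀| ≤ dist x x₀ := by
    simpa [Real.dist_eq] using hφ.dist_le_mul x x₀
  have h₀ : ∫ x, φ x ∂m₀ ≤ ∫ x, (dist x x₀ + φ x₀) ∂m₀ :=
    integral_mono (hm₀.integrable_of_lipschitzWith hφ) (hx₀.add (integrable_const _))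
      fun x => sub_le_iff_le_add.1 (abs_le.1 (hle x)).2
  have h₁ : ∫ x, (φ x₀ - dist x x₀) ∂m₁ ≤ ∫ x, φ x ∂m₁ :=
    integral_mono ((integrable_const _).sub hx₁) (hm₁.integrable_of_lipschitzWith hφ)
      fun x => by linarith [(abs_le.1 (hle x)).1]
  rw [integral_add hx₀ (integrable_const _), integral_const, probReal_univ, one_smul] at h₀
  rw [integral_sub (integrable_const _) hx₁, integral_const, probReal_univ, one_smul] at h₁
  linarith

lemma le_krDist (hm₀ : FiniteFirstMoment m₀) (hm₁ : FiniteFirstMoment m₁) {φ : X → ℝ}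
    (hφ : LipschitzWith 1 φ) : (∫ x, φ x ∂m₀) - ∫ x, φ x ∂m₁ ≤ krDist m₀ m₁ :=
  le_ciSup (bddAbove_krDist hm₀ hm₁) ⟨φ, hφ⟩

lemma krDist_nonneg (hm₀ : FiniteFirstMoment m₀) (hm₁ : FiniteFirstMoment m₁) :
    0 ≤ krDist m₀ m₁ := by
  simpa only [integral_zero, sub_zero] using le_krDist hm₀ hm₁ (LipschitzWith.const' (0 : ℝ))

theorem exists_coupling_lintegral_edist_le_of_finite [Finite X] (m₀ m₁ : Measure X)
    [IsProbabilityMeasure m₀] [IsProbabilityMeasure m₁] :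
    ∃ ρ ∈ couplings m₀ m₁, ∫⁻ p, edist p.1 p.2 ∂ρ ≤ ENNReal.ofReal (krDist m₀ m₁) := by
  obtain ⟨x₀⟩ := nonempty_of_isProbabilityMeasure m₀
  have hm₀ : FiniteFirstMoment m₀ := ⟨inferInstance, x₀, .of_finite⟩
  have hm₁ : FiniteFirstMoment m₁ := ⟨inferInstance, x₀, .of_finite⟩
  obtain ⟨ρ, hρ, hle⟩ := exists_coupling_integral_le_of_finite m₀ m₁ (fun x y => dist x y)
    fun φ ψ hφψ => by
      obtain ⟨Φ, hΦ, hφΦ, hΦψ⟩ := exists_lipschitzWith_between hφψ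
      calc ∫ x, φ x ∂m₀ + ∫ x, ψ x ∂m₁ ≤ ∫ x, Φ x ∂m₀ + ∫ x, -Φ x ∂m₁ := add_le_add
            (integral_mono .of_finite .of_finite hφΦ)
            (integral_mono .of_finite .of_finite fun x => le_neg_of_le_neg (hΦψ x))
        _ = (∫ x, Φ x ∂m₀) - ∫ x, Φ x ∂m₁ := by rw [integral_neg, sub_eq_add_neg]
        _ ≤ krDist m₀ m₁ := le_krDist hm₀ hm₁ hΦ
  have := hρ.1
  refine ⟨ρ, hρ, ?_⟩
  simp only [edist_dist]
  rw [← ofReal_integral_eq_lintegral_ofReal .of_finite (.of_forall fun _ => dist_nonneg)]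
  exact ENNReal.ofReal_le_ofReal hle

lemma abs_integral_comp_sub_integral_le {m : Measure X} (hm : FiniteFirstMoment m) {T : X → X}
    (hT : Measurable T) {ε : ℝ} (hε : 0 ≤ ε) (hTε : ∫⁻ x, edist x (T x) ∂m ≤ ENNReal.ofReal ε)
    {φ : X → ℝ} (hφ : LipschitzWith 1 φ) : |(∫ x, φ (T x) ∂m) - ∫ x, φ x ∂m| ≤ ε := by
  have hle : ∫⁻ x, ‖φ (T x) - φ x‖ₑ ∂m ≤ ENNReal.ofReal ε := by
    refine (lintegral_mono fun x => ?_).trans hTε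
    simpa only [edist_eq_enorm_sub, ENNReal.coe_one, one_mul, edist_comm x] using
      hφ.edist_le_mul (T x) x
  have hφm := hφ.continuous.measurable
  have hdiff : Integrable (fun x => φ (T x) - φ x) m :=
    ⟨((hφm.comp hT).sub hφm).aestronglyMeasurable, hle.trans_lt ENNReal.ofReal_lt_top⟩
  have hφi := hm.integrable_of_lipschitzWith hφ
  have hφT : Integrable (fun x => φ (T x)) m :=
    (hdiff.add hφi).congr (.of_forall fun x => sub_add_cancel (φ (T x)) (φ x))
  rw [← integral_sub hφT hφi, ← Real.norm_eq_abs]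
  refine (norm_integral_le_lintegral_norm _).trans (ENNReal.toReal_le_of_le_ofReal hε ?_)
  simpa only [ofReal_norm] using hle

lemma krDist_map_rangeFactorization_le (hm₀ : FiniteFirstMoment m₀) (hm₁ : FiniteFirstMoment m₁)
    {T : X → X} (hT : Measurable T) {ε : ℝ} (hε : 0 ≤ ε)
    (h₀ : ∫⁻ x, edist x (T x) ∂m₀ ≤ ENNReal.ofReal ε)
    (h₁ : ∫⁻ x, edist x (T x) ∂m₁ ≤ ENNReal.ofReal ε) :
    krDist (m₀.map (rangeFactorization T)) (m₁.map (rangeFactorization T)) ≤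
      krDist m₀ m₁ + 2 * ε := by
  have hT' : Measurable (rangeFactorization T) := hT.subtype_mk
  have : Nonempty {φ : range T → ℝ // LipschitzWith 1 φ} := ⟨⟨fun _ => 0, LipschitzWith.const' 0⟩⟩
  refine ciSup_le fun ⟨φ, hφ⟩ => ?_
  obtain ⟨Φ, hΦ, hΦφ⟩ := exists_lipschitzWith_comp_val_eq hφ
  have hmap (m : Measure X) : ∫ x, φ x ∂m.map (rangeFactorization T) = ∫ x, Φ (T x) ∂m := by
    rw [integral_map hT'.aemeasurable hφ.continuous.measurable.aestronglyMeasurable]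
    simp only [← hΦφ, rangeFactorization_coe]
  rw [hmap, hmap]
  have hε₀ := (abs_le.1 (abs_integral_comp_sub_integral_le hm₀ hT hε h₀ hΦ)).2
  have hε₁ := (abs_le.1 (abs_integral_comp_sub_integral_le hm₁ hT hε h₁ hΦ)).1
  linarith [le_krDist hm₀ hm₁ hΦ]

variable [SecondCountableTopology X]

lemma tendsto_lintegral_edist_nearestPt {m : Measure X} (hm : FiniteFirstMoment m) {e : ℕ → X}
    (he : DenseRange e) :
    Tendsto (fun n => ∫⁻ x, edist x (SimpleFunc.nearestPt e n x) ∂m) atTop (𝓝 0) := by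
  rw [← lintegral_zero (μ := m)]
  refine tendsto_lintegral_of_dominated_convergence (fun x => edist x (e 0))
    (fun n => measurable_id.edist (SimpleFunc.measurable _)) (fun n => .of_forall fun x => ?_)
    (hm.lintegral_edist_ne_top (e 0)) (.of_forall fun x => ?_)
  · simpa only [edist_comm] using SimpleFunc.edist_nearestPt_le e x (Nat.zero_le n)
  · simpa only [edist_self] using
      (tendsto_const_nhds (x := x)).edist (SimpleFunc.tendsto_nearestPt (he x))

lemma exists_simpleFunc_lintegral_edist_le (hm₀ : FiniteFirstMoment m₀)
    (hm₁ : FiniteFirstMoment m₁) {ε : ℝ≥0∞} (hε : 0 < ε) :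
    ∃ T : SimpleFunc X X, ∫⁻ x, edist x (T x) ∂m₀ ≤ ε ∧ ∫⁻ x, edist x (T x) ∂m₁ ≤ ε := by
  obtain ⟨x₀, -⟩ := hm₀.2
  have : Nonempty X := ⟨x₀⟩
  have he := TopologicalSpace.denseRange_denseSeq X
  obtain ⟨n, h₀, h₁⟩ := (((tendsto_lintegral_edist_nearestPt hm₀ he).eventually_le_const hε).and
    ((tendsto_lintegral_edist_nearestPt hm₁ he).eventually_le_const hε)).exists
  exact ⟨_, h₀, h₁⟩

lemma lintegral_edist_le_of_map_prodMap {ρ : Measure (X × X)} (hρ : ρ ∈ couplings m₀ m₁)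
    {T : X → X} (hT : Measurable T) :
    ∫⁻ p, edist p.1 p.2 ∂ρ ≤ ∫⁻ x, edist x (T x) ∂m₀ + ∫⁻ p, edist (T p.1) (T p.2) ∂ρ +
      ∫⁻ x, edist x (T x) ∂m₁ := by
  obtain ⟨-, rfl, rfl⟩ := hρ
  rw [lintegral_map (by fun_prop) measurable_fst, lintegral_map (by fun_prop) measurable_snd,
    ← lintegral_add_left (by fun_prop), ← lintegral_add_left (by fun_prop)]
  refine lintegral_mono fun p => ?_
  rw [edist_comm p.2 (T p.2)]
  exact edist_triangle4 _ _ _ _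

variable [CompleteSpace X]

lemma exists_coupling_lintegral_edist_le (hm₀ : FiniteFirstMoment m₀)
    (hm₁ : FiniteFirstMoment m₁) {ε : ℝ} (hε : 0 < ε) :
    ∃ ρ ∈ couplings m₀ m₁, ∫⁻ p, edist p.1 p.2 ∂ρ ≤ ENNReal.ofReal (krDist m₀ m₁ + 4 * ε) := by
  have hp₀ := hm₀.1
  have hp₁ := hm₁.1
  obtain ⟨T, h₀, h₁⟩ := exists_simpleFunc_lintegral_edist_le hm₀ hm₁ (ENNReal.ofReal_pos.2 hε)
  have : Finite (range T) := T.finite_range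
  have hT : Measurable (rangeFactorization T) := T.measurable.subtype_mk
  have := Measure.isProbabilityMeasure_map (μ := m₀) hT.aemeasurable
  have := Measure.isProbabilityMeasure_map (μ := m₁) hT.aemeasurable
  obtain ⟨σ, hσ, hσle⟩ := exists_coupling_lintegral_edist_le_of_finite
    (m₀.map (rangeFactorization T)) (m₁.map (rangeFactorization T))
  obtain ⟨ρ, hρ, rfl⟩ := exists_coupling_map_eq hT hT hσ
  rw [lintegral_map (by fun_prop) (by fun_prop)] at hσle
  have hkr := krDist_map_rangeFactorization_le hm₀ hm₁ T.measurable hε.le h₀ h₁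
  have hnonneg := krDist_nonneg hm₀ hm₁
  refine ⟨ρ, hρ, ?_⟩
  calc ∫⁻ p, edist p.1 p.2 ∂ρ
      ≤ ∫⁻ x, edist x (T x) ∂m₀ + ∫⁻ p, edist (T p.1) (T p.2) ∂ρ + ∫⁻ x, edist x (T x) ∂m₁ :=
        lintegral_edist_le_of_map_prodMap hρ T.measurable
    _ ≤ ENNReal.ofReal ε + ENNReal.ofReal (krDist m₀ m₁ + 2 * ε) + ENNReal.ofReal ε :=
        add_le_add (add_le_add h₀ (hσle.trans (ENNReal.ofReal_le_ofReal hkr))) h₁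
    _ = ENNReal.ofReal (krDist m₀ m₁ + 4 * ε) := by
        rw [← ENNReal.ofReal_add (by linarith) (by linarith),
          ← ENNReal.ofReal_add (by linarith) (by linarith)]
        congr 1
        ring

theorem IsOptimalCoupling.lintegral_edist_le (hm₀ : FiniteFirstMoment m₀)
    (hm₁ : FiniteFirstMoment m₁) {ρ : Measure (X × X)} (hρ : IsOptimalCoupling m₀ m₁ ρ) :
    ∫⁻ p, edist p.1 p.2 ∂ρ ≤ ENNReal.ofReal (krDist m₀ m₁) := by
  have hcont : Continuous fun ε : ℝ => ENNReal.ofReal (krDist m₀ m₁ + 4 * ε) :=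
    ENNReal.continuous_ofReal.comp (by fun_prop)
  have hlim : Tendsto (fun ε : ℝ => ENNReal.ofReal (krDist m₀ m₁ + 4 * ε)) (𝓝[>] 0)
      (𝓝 (ENNReal.ofReal (krDist m₀ m₁))) := by
    simpa only [mul_zero, add_zero] using hcont.tendsto 0 |>.mono_left nhdsWithin_le_nhds
  refine ge_of_tendsto hlim ?_
  filter_upwards [self_mem_nhdsWithin] with ε hε
  obtain ⟨ρ', hρ', hle⟩ := exists_coupling_lintegral_edist_le hm₀ hm₁ hε
  exact (hρ.2 ρ' hρ').trans hle

end KantorovichRubinstein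

lemma sub_le_inner_gradient {H : Type*} [NormedAddCommGroup H] [InnerProductSpace ℝ H]
    [CompleteSpace H] {f : H → ℝ} (hf : ConvexOn ℝ univ f) {b : H} (hd : DifferentiableAt ℝ f b)
    (a : H) : f b - f a ≤ inner ℝ (gradient f b) (b - a) := by
  have hconv : ConvexOn ℝ univ fun t : ℝ => f (AffineMap.lineMap a b t) :=
    hf.comp_affineMap (AffineMap.lineMap a b)
  have hderiv : HasDerivAt (fun t : ℝ => f (AffineMap.lineMap a b t))
      (inner ℝ (gradient f b) (b - a)) 1 := by
    have hgrad : HasFDerivAt f (InnerProductSpace.toDual ℝ H (gradient f b))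
        (AffineMap.lineMap a b (1 : ℝ)) := by
      rw [AffineMap.lineMap_apply_one]
      exact hd.hasGradientAt.hasFDerivAt
    exact hgrad.comp_hasDerivAt (1 : ℝ) AffineMap.hasDerivAt_lineMap
  simpa only [slope_def_field, AffineMap.lineMap_apply_one, AffineMap.lineMap_apply_zero, sub_zero,
    div_one] using hconv.slope_le_of_hasDerivAt (mem_univ 0) (mem_univ 1) zero_lt_one hderiv

lemma norm_integral_le_of_forall_norm_le {α G : Type*} [MeasurableSpace α] [NormedAddCommGroup G]
    [NormedSpace ℝ G] {g : α → G} {B : ℝ} (hB : ∀ z, ‖g z‖ ≤ B) (μ : Measure α)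
    [IsProbabilityMeasure μ] : ‖∫ z, g z ∂μ‖ ≤ B := by
  simpa only [probReal_univ, mul_one] using
    norm_integral_le_of_norm_le_const (μ := μ) (.of_forall hB)

section Cost

variable {X Y H : Type*} [NormedAddCommGroup H] {F : X → Set Y} {g : graph F → H}

lemma constM_nonneg : 0 ≤ constM g := Real.iSup_nonneg fun _ => norm_nonneg _

variable [MeasurableSpace X] [MeasurableSpace Y] [InnerProductSpace ℝ H] [CompleteSpace H]
  {f : H → ℝ}

lemma norm_gradient_integral_le_constC {L : ℝ≥0} (hg : ∃ B, ∀ z, ‖g z‖ ≤ B)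
    (hL : LipschitzWith L (gradient f)) (μ : Measure (graph F)) [IsProbabilityMeasure μ] :
    ‖gradient f (∫ z, g z ∂μ)‖ ≤ constC g f := by
  obtain ⟨B, hB⟩ := hg
  refine le_ciSup (f := fun μ : ProbabilityMeasure (graph F) =>
    ‖gradient f (∫ z, g z ∂(μ : Measure (graph F)))‖)
    ⟨L * B + ‖gradient f 0‖, forall_mem_range.2 fun μ' => ?_⟩ ⟨μ, inferInstance⟩
  have hle : ‖gradient f (∫ z, g z ∂(μ' : Measure (graph F))) - gradient f 0‖ ≤ L * B :=
    calc _ ≤ L * ‖(∫ z, g z ∂(μ' : Measure (graph F))) - 0‖ := hL.norm_sub_le _ _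
      _ ≤ L * B := by
          rw [sub_zero]
          gcongr
          exact norm_integral_le_of_forall_norm_le hB _
  exact (norm_le_norm_sub_add _ _).trans (by gcongr)

lemma bddBelow_cost (hg : ∃ B, ∀ z, ‖g z‖ ≤ B) (hf : ConvexOn ℝ univ f)
    (hfd : DifferentiableAt ℝ f 0) (m : Measure X) : BddBelow (cost g f '' admissible F m) := by
  obtain ⟨B, hB⟩ := hg
  refine ⟨f 0 - ‖gradient f 0‖ * B, forall_mem_image.2 fun μ ⟨hμ, _⟩ => ?_⟩
  rw [sub_le_comm]
  calc f 0 - f (∫ z, g z ∂μ) ≤ inner ℝ (gradient f 0) (0 - ∫ z, g z ∂μ) :=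
        sub_le_inner_gradient hf hfd _
    _ ≤ ‖gradient f 0‖ * ‖0 - ∫ z, g z ∂μ‖ := real_inner_le_norm _ _
    _ ≤ ‖gradient f 0‖ * B := by
        rw [zero_sub, norm_neg]
        gcongr
        exact norm_integral_le_of_forall_norm_le hB μ

lemma cost_sub_cost_le (hf : ConvexOn ℝ univ f) {μ μ' : Measure (graph F)}
    (hfd : DifferentiableAt ℝ f (∫ z, g z ∂μ)) :
    cost g f μ - cost g f μ' ≤
      ‖gradient f (∫ z, g z ∂μ)‖ * ‖(∫ z, g z ∂μ) - ∫ z, g z ∂μ'‖ :=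
  (sub_le_inner_gradient hf hfd _).trans (real_inner_le_norm _ _)

end Cost

section Bridging

variable {X Y H : Type*} [MetricSpace X] [MeasurableSpace X] [MeasurableSpace Y]
  [NormedAddCommGroup H] {F : X → Set Y} {g : graph F → H} {Lg : ℝ}
  {m₀ m₁ : Measure X} {μ₀ μ₁ : Measure (graph F)}

lemma IsBridgingOutput.mem_admissible (h : IsBridgingOutput g Lg m₀ m₁ μ₀ μ₁) :
    μ₁ ∈ admissible F m₁ := by
  obtain ⟨ρ, ν, s, hρ, hν, -, hνρ, hs, hst, rfl⟩ := h
  refine ⟨Measure.isProbabilityMeasure_map hs.aemeasurable, ?_⟩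
  rw [Measure.map_map (by fun_prop) hs, ← hρ.1.2.2, ← hνρ,
    Measure.map_map (by fun_prop) (by fun_prop)]
  exact congrArg (ν.map ·) (funext fun p => (hst p).1)

variable [BorelSpace X] [SecondCountableTopology X] [MetricSpace Y] [BorelSpace Y]
  [SecondCountableTopology Y]

lemma admissible_nonempty (hn : ∀ x, (F x).Nonempty) (hc : ∀ x, IsCompact (F x))
    (hu : UpperHemicontinuous F) (m : Measure X) [IsProbabilityMeasure m] :
    (admissible F m).Nonempty := by
  obtain ⟨s, hs, hsx⟩ := exists_measurable_section_graph_fst hn hc hu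
  refine ⟨m.map s, Measure.isProbabilityMeasure_map hs.aemeasurable, ?_⟩
  have hid : (fun z : graph F => z.1.1) ∘ s = id := funext hsx
  rw [Measure.map_map (by fun_prop) hs, hid, Measure.map_id]

theorem exists_isBridgingOutput [CompleteSpace X] [IsProbabilityMeasure m₀]
    [IsProbabilityMeasure m₁] (hstab : StabilityAssumption g Lg) (hμ₀ : μ₀ ∈ admissible F m₀) :
    ∃ μ₁, IsBridgingOutput g Lg m₀ m₁ μ₀ μ₁ := by
  obtain ⟨hprob, rfl⟩ := hμ₀
  obtain ⟨ρ, hρ⟩ := exists_isOptimalCoupling (μ₀.map fun z => z.1.1) m₁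
  obtain ⟨ν, hν, hνρ⟩ := exists_gluing (by fun_prop) hρ.1
  obtain ⟨s, hs, hst⟩ := exists_measurable_transfer hstab
  exact ⟨_, ρ, ν, s, hρ, hν.1, hν.2.1, hνρ, hs, hst, rfl⟩

end Bridging

section Stability

variable {X Y H : Type*} [MetricSpace X] [MeasurableSpace X] [BorelSpace X]
  [SecondCountableTopology X] [MetricSpace Y] [MeasurableSpace Y] [BorelSpace Y]
  [SecondCountableTopology Y] [NormedAddCommGroup H] [InnerProductSpace ℝ H]
  {F : X → Set Y} {g : graph F → H} {f : H → ℝ} {Lg C : ℝ}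
  {m₀ m₁ : Measure X} {μ₀ μ₁ : Measure (graph F)}

theorem IsBridgingOutput.norm_integral_sub_le [CompleteSpace X] (hg : ∃ B, ∀ z, ‖g z‖ ≤ B)
    (hgc : Continuous g) (hLg : 0 ≤ Lg) (hm₀ : FiniteFirstMoment m₀) (hm₁ : FiniteFirstMoment m₁)
    (h : IsBridgingOutput g Lg m₀ m₁ μ₀ μ₁) :
    ‖(∫ z, g z ∂μ₁) - ∫ z, g z ∂μ₀‖ ≤ Lg * krDist m₀ m₁ := by
  obtain ⟨ρ, ν, s, hρ, hν, rfl, rfl, hs, hst, rfl⟩ := h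
  obtain ⟨B, hB⟩ := hg
  have hgm : StronglyMeasurable g := hgc.stronglyMeasurable
  have hle := hρ.lintegral_edist_le hm₀ hm₁
  rw [lintegral_map (by fun_prop) (by fun_prop)] at hle
  have hdist : Integrable (fun p : graph F × X => dist p.1.1.1 p.2) ν := by
    refine ⟨by fun_prop, (lintegral_mono fun p => ?_).trans_lt (hle.trans_lt ENNReal.ofReal_lt_top)⟩
    rw [Real.enorm_of_nonneg dist_nonneg, edist_dist]
  have hdist_le : ∫ p, dist p.1.1.1 p.2 ∂ν ≤ krDist m₀ m₁ := by
    rw [integral_eq_lintegral_of_nonneg_ae (.of_forall fun _ => dist_nonneg)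
      hdist.aestronglyMeasurable]
    refine ENNReal.toReal_le_of_le_ofReal (krDist_nonneg hm₀ hm₁) ?_
    simpa only [edist_dist] using hle
  have hint {u : graph F × X → graph F} (hu : Measurable u) : Integrable (fun p => g (u p)) ν :=
    .of_bound (hgm.comp_measurable hu).aestronglyMeasurable B (.of_forall fun p => hB _)
  calc ‖(∫ z, g z ∂ν.map s) - ∫ z, g z ∂ν.map Prod.fst‖
      = ‖∫ p, (g (s p) - g p.1) ∂ν‖ := by
        rw [integral_map hs.aemeasurable hgm.aestronglyMeasurable,
          integral_map (by fun_prop) hgm.aestronglyMeasurable,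
          integral_sub (hint hs) (hint measurable_fst)]
    _ ≤ ∫ p, Lg * dist p.1.1.1 p.2 ∂ν :=
        norm_integral_le_of_norm_le (hdist.const_mul Lg) (.of_forall fun p => (hst p).2)
    _ = Lg * ∫ p, dist p.1.1.1 p.2 ∂ν := integral_const_mul _ _
    _ ≤ Lg * krDist m₀ m₁ := mul_le_mul_of_nonneg_left hdist_le hLg

variable [CompleteSpace H]

theorem isGLB_val (hn : ∀ x, (F x).Nonempty) (hc : ∀ x, IsCompact (F x))
    (hu : UpperHemicontinuous F) (hg : ∃ B, ∀ z, ‖g z‖ ≤ B) (hf : ConvexOn ℝ univ f)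
    (hfd : DifferentiableAt ℝ f 0) (m : Measure X) [IsProbabilityMeasure m] :
    IsGLB (cost g f '' admissible F m) (val g f m) :=
  isGLB_csInf ((admissible_nonempty hn hc hu m).image _) (bddBelow_cost hg hf hfd m)

variable [CompleteSpace X] (hn : ∀ x, (F x).Nonempty) (hg : ∃ B, ∀ z, ‖g z‖ ≤ B)
  (hf : ConvexOn ℝ univ f) (hfd : Differentiable ℝ f)
  (hC : ∀ μ : Measure (graph F), IsProbabilityMeasure μ → ‖gradient f (∫ z, g z ∂μ)‖ ≤ C)
  (hstab : StabilityAssumption g Lg) (hm₀ : FiniteFirstMoment m₀) (hm₁ : FiniteFirstMoment m₁)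

include hg hf hfd hC hstab hm₀ hm₁

theorem IsBridgingOutput.cost_le (h : IsBridgingOutput g Lg m₀ m₁ μ₀ μ₁) :
    cost g f μ₁ ≤ cost g f μ₀ + Lg * C * krDist m₀ m₁ := by
  have hgrad := hC μ₁ h.mem_admissible.1
  rw [← sub_le_iff_le_add']
  calc cost g f μ₁ - cost g f μ₀
      ≤ ‖gradient f (∫ z, g z ∂μ₁)‖ * ‖(∫ z, g z ∂μ₁) - ∫ z, g z ∂μ₀‖ :=
        cost_sub_cost_le hf (hfd _)
    _ ≤ C * (Lg * krDist m₀ m₁) :=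
        mul_le_mul hgrad
          (h.norm_integral_sub_le hg hstab.continuous hstab.modulus_nonneg hm₀ hm₁)
          (norm_nonneg _) ((norm_nonneg _).trans hgrad)
    _ = Lg * C * krDist m₀ m₁ := by ring

include hn

theorem val_le_val_add : val g f m₁ ≤ val g f m₀ + Lg * C * krDist m₀ m₁ := by
  have := hm₀.1
  have := hm₁.1
  have hglb (m : Measure X) [IsProbabilityMeasure m] :=
    isGLB_val hn hstab.compact hstab.usc hg hf (hfd 0) m
  rw [← sub_le_iff_le_add]
  refine (hglb m₀).2 (forall_mem_image.2 fun μ₀ hμ₀ => ?_)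
  obtain ⟨μ₁, hμ₁⟩ := exists_isBridgingOutput (m₁ := m₁) hstab hμ₀
  rw [sub_le_iff_le_add]
  exact ((hglb m₁).1 (mem_image_of_mem _ hμ₁.mem_admissible)).trans
    (hμ₁.cost_le hg hf hfd hC hstab hm₀ hm₁)

theorem abs_val_sub_val_le : |val g f m₀ - val g f m₁| ≤ Lg * C * krDist m₀ m₁ := by
  have h₀₁ := val_le_val_add hn hg hf hfd hC hstab hm₀ hm₁
  have h₁₀ := val_le_val_add hn hg hf hfd hC hstab hm₁ hm₀
  rw [krDist_comm m₁ m₀] at h₁₀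
  exact abs_sub_le_iff.2 ⟨sub_le_iff_le_add'.2 h₁₀, sub_le_iff_le_add'.2 h₀₁⟩

theorem IsBridgingOutput.isApproxMinimizer {ε : ℝ} (hμ₀ : IsApproxMinimizer g f m₀ ε μ₀)
    (h : IsBridgingOutput g Lg m₀ m₁ μ₀ μ₁) :
    IsApproxMinimizer g f m₁ (ε + 2 * Lg * C * krDist m₀ m₁) μ₁ := by
  have := hm₀.1
  have := hm₁.1
  have hglb (m : Measure X) [IsProbabilityMeasure m] :=
    isGLB_val hn hstab.compact hstab.usc hg hf (hfd 0) m
  refine ⟨h.mem_admissible, fun μ hμ => ?_⟩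
  have hμ₀_le : cost g f μ₀ - ε ≤ val g f m₀ :=
    (hglb m₀).2 (forall_mem_image.2 fun μ' hμ' => sub_le_iff_le_add.2 (hμ₀.2 μ' hμ'))
  have hval := val_le_val_add hn hg hf hfd hC hstab hm₁ hm₀
  rw [krDist_comm] at hval
  calc cost g f μ₁ ≤ cost g f μ₀ + Lg * C * krDist m₀ m₁ :=
        h.cost_le hg hf hfd hC hstab hm₀ hm₁
    _ ≤ val g f m₁ + (ε + 2 * Lg * C * krDist m₀ m₁) := by linarith
    _ ≤ cost g f μ + (ε + 2 * Lg * C * krDist m₀ m₁) := by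
        gcongr
        exact (hglb m₁).1 (mem_image_of_mem _ hμ)

end Stability

end MFO

theorem theorem4p1_general {X Y H : Type*} [MetricSpace X] [CompleteSpace X]
    [SecondCountableTopology X] [MeasurableSpace X] [BorelSpace X] [MetricSpace Y]
    [SecondCountableTopology Y] [MeasurableSpace Y] [BorelSpace Y] [NormedAddCommGroup H]
    [InnerProductSpace ℝ H] [CompleteSpace H] {F : X → Set Y} (hF : ∀ x, (F x).Nonempty)
    {g : MFO.graph F → H} (hg : ∃ B, ∀ z, ‖g z‖ ≤ B) {f : H → ℝ} (hf : ConvexOn ℝ univ f)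
    (hfd : Differentiable ℝ f) {C : ℝ}
    (hC : ∀ μ : Measure (MFO.graph F), IsProbabilityMeasure μ →
      ‖gradient f (∫ z, g z ∂μ)‖ ≤ C)
    {Lg : ℝ} (hstab : MFO.StabilityAssumption g Lg) {m₀ m₁ : Measure X}
    (hm₀ : MFO.FiniteFirstMoment m₀) (hm₁ : MFO.FiniteFirstMoment m₁) :
    (IsGLB (MFO.cost g f '' MFO.admissible F m₀) (MFO.val g f m₀) ∧
      IsGLB (MFO.cost g f '' MFO.admissible F m₁) (MFO.val g f m₁) ∧
      |MFO.val g f m₀ - MFO.val g f m₁| ≤ Lg * C * MFO.krDist m₀ m₁) ∧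
    ∀ (ε₀ : ℝ) (μ₀ : Measure (MFO.graph F)), MFO.IsApproxMinimizer g f m₀ ε₀ μ₀ →
      (∃ μ₁, MFO.IsBridgingOutput g Lg m₀ m₁ μ₀ μ₁) ∧
      ∀ μ₁, MFO.IsBridgingOutput g Lg m₀ m₁ μ₀ μ₁ →
        MFO.IsApproxMinimizer g f m₁ (ε₀ + 2 * Lg * C * MFO.krDist m₀ m₁) μ₁ := by
  have := hm₀.1
  have := hm₁.1
  have hglb (m : Measure X) [IsProbabilityMeasure m] :=
    MFO.isGLB_val hF hstab.compact hstab.usc hg hf (hfd 0) m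
  exact ⟨⟨hglb m₀, hglb m₁, MFO.abs_val_sub_val_le hF hg hf hfd hC hstab hm₀ hm₁⟩,
    fun ε₀ μ₀ hμ₀ => ⟨MFO.exists_isBridgingOutput hstab hμ₀.1,
      fun μ₁ h => h.isApproxMinimizer hF hg hf hfd hC hstab hm₀ hm₁ hμ₀⟩⟩

theorem theorem4p1
    {E : Type*} [NormedAddCommGroup E] [NormedSpace ℝ E] [CompleteSpace E]
    [TopologicalSpace.SeparableSpace E] [MeasurableSpace E] [BorelSpace E]
    (X : Set E) (hX : IsClosed X)
    {Y : Type*} [MetricSpace Y] [CompleteSpace Y] [TopologicalSpace.SeparableSpace Y]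
    [MeasurableSpace Y] [BorelSpace Y]
    {H : Type*} [NormedAddCommGroup H] [InnerProductSpace ℝ H] [CompleteSpace H]
    [TopologicalSpace.SeparableSpace H]
    (F : X → Set Y) (hF_closed : IsClosed (MFO.graph F)) (hF_nonempty : ∀ x, (F x).Nonempty)
    (g : MFO.graph F → H) (f : H → ℝ) (L : NNReal) (Lg : ℝ)
    (hcost : MFO.CostAssumption g f L) (hstab : MFO.StabilityAssumption g Lg)
    (m₀ m₁ : MeasureTheory.Measure X)
    (hm₀ : MFO.FiniteFirstMoment m₀) (hm₁ : MFO.FiniteFirstMoment m₁) :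
    -- the two values are genuine (finite) infima, and they are close to each other
    (IsGLB (MFO.cost g f '' MFO.admissible F m₀) (MFO.val g f m₀) ∧
      IsGLB (MFO.cost g f '' MFO.admissible F m₁) (MFO.val g f m₁) ∧
      |MFO.val g f m₀ - MFO.val g f m₁| ≤
        Lg * (MFO.constC g f + L * MFO.constM g) * MFO.krDist m₀ m₁) ∧
    -- the bridging method has an output, and each output is an approximate minimizer
    (∀ (ε₀ : ℝ) (μ₀ : MeasureTheory.Measure (MFO.graph F)), 0 ≤ ε₀ →
      MFO.IsApproxMinimizer g f m₀ ε₀ μ₀ →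
      (∃ μ₁, MFO.IsBridgingOutput g Lg m₀ m₁ μ₀ μ₁) ∧
      ∀ μ₁, MFO.IsBridgingOutput g Lg m₀ m₁ μ₀ μ₁ →
        MFO.IsApproxMinimizer g f m₁
          (ε₀ + 2 * Lg * (MFO.constC g f + L * MFO.constM g) * MFO.krDist m₀ m₁) μ₁) := by
  have := UniformSpace.secondCountable_of_separable E
  have := UniformSpace.secondCountable_of_separable Y
  have := hX.completeSpace_coe
  have hC (μ : Measure (MFO.graph F)) (_ : IsProbabilityMeasure μ) :
      ‖gradient f (∫ z, g z ∂μ)‖ ≤ MFO.constC g f + L * MFO.constM g :=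
    (MFO.norm_gradient_integral_le_constC hcost.bounded hcost.lipschitz_gradient μ).trans
      (le_add_of_nonneg_right (mul_nonneg L.2 MFO.constM_nonneg))
  obtain ⟨hval, hout⟩ := theorem4p1_general hF_nonempty hcost.bounded hcost.convex
    hcost.differentiable hC hstab hm₀ hm₁
  exact ⟨hval, fun ε₀ μ₀ _ => hout ε₀ μ₀⟩
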